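/- Equip $\mathbb{R}^{m\times n}$ with the trace inner product $\langle A,B\rangle=\operatorname{tr}(A^{\mathsf T}B)$ and the Euclidean norm $\|A\|_2=\sqrt{\langle A,A\rangle}$. For a nonempty bounded set $S\subseteq\mathbb{R}^{m\times n}$ and $\rho>0$, let $N_S(\rho)$ be the least number of open balls of radius $\rho$, with centres in $\mathbb{R}^{m\times n}$, whose union contains $S$, and let $$\underline{\dim}_{\mathrm B}(S)=\liminf_{\rho\to 0^+}\frac{\log N_S(\rho)}{\log(1/\rho)}$$ be the lower Minkowski (box-counting) dimension of $S$. Let $X$ be a random matrix in $\mathbb{R}^{m\times n}$ of arbitrary distribution, let $\varepsilon\ge 0$, and let $S\subseteq\mathbb{R}^{m\times n}$ be an $\varepsilon$-support set of $X$, that is, a nonempty bounded set with $\Pr[X\in S]\ge 1-\varepsilon$. Let $k\in\mathbb{N}$ satisfy $k>\underline{\dim}_{\mathrm B}(S)$. Then for Lebesgue-almost all $(A_1,\dots,A_k)\in(\mathbb{R}^{m\times n})^k$ there exists a measurable map (decoder) $g:\mathbb{R}^k\to\mathbb{R}^{m\times n}$ such that $$\Pr\big[g\big(\langle A_1,X\rangle,\dots,\langle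 A_k,X\rangle\big)\neq X\big]\le\varepsilon.$$ -/

import Mathlib

open MeasureTheory Filter Topology

-- The norm on matrices is the Euclidean (Frobenius) norm `‖A‖ = √(tr (Aᵀ A))`.
attribute [local instance] Matrix.frobeniusNormedAddCommGroup

namespace MatrixCompletion

noncomputable section

/-- The Borel σ-algebra on `ℝ^{m × n}`, as the product of the Borel σ-algebras of the entries. -/
instance instMeasurableSpaceMatrix {m n : ℕ} : MeasurableSpace (Matrix (Fin m) (Fin n) ℝ) :=
  inferInstanceAs (MeasurableSpace (Fin m → Fin n → ℝ))

/-- The covering number `N_S(ρ)`: the least number of open balls of radius `ρ`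
(with arbitrary centres in the ambient space) that cover `S`. -/
def coveringNumber {E : Type*} [PseudoMetricSpace E] (S : Set E) (ρ : ℝ) : ℕ :=
  sInf {N : ℕ | ∃ c : Fin N → E, S ⊆ ⋃ i, Metric.ball (c i) ρ}

/-- The lower Minkowski (box-counting) dimension
`liminf_{ρ → 0+} log N_S(ρ) / log (1 / ρ)` of a nonempty bounded set `S`. The lower limit is taken
in the extended reals. -/
def lowerMinkowskiDim {E : Type*} [PseudoMetricSpace E] (S : Set E) : EReal :=
  liminf (fun ρ : ℝ =>
    ((Real.log (coveringNumber S ρ : ℝ) / Real.log (1 / ρ) : ℝ) : EReal)) (𝓝[>] (0 : ℝ))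

/-- The trace inner product `⟨A, B⟩ = tr (Aᵀ B)`. -/
def traceInner {m n : ℕ} (A B : Matrix (Fin m) (Fin n) ℝ) : ℝ :=
  (A.transpose * B).trace

/-- The measurement map `X ↦ (⟨A₁, X⟩, …, ⟨A_k, X⟩)`. -/
def measurements {m n k : ℕ} (A : Fin k → Matrix (Fin m) (Fin n) ℝ)
    (X : Matrix (Fin m) (Fin n) ℝ) : Fin k → ℝ :=
  fun i => traceInner (A i) X

/-- Lebesgue measure on `ℝ^{m × n}` (the product of the Lebesgue measures of the entries). -/
def matrixLebesgue (m n : ℕ) : Measure (Matrix (Fin m) (Fin n) ℝ) :=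
  (volume : Measure (Fin m → Fin n → ℝ))

/-- `S` is an `ε`-support set of the random matrix `X`: `ε ≥ 0`, `S` is nonempty and bounded,
and `Pr[X ∈ S] ≥ 1 - ε`. -/
structure IsSupportSet {Ω : Type*} [MeasurableSpace Ω] (P : Measure Ω) {m n : ℕ}
    (X : Ω → Matrix (Fin m) (Fin n) ℝ) (ε : ℝ) (S : Set (Matrix (Fin m) (Fin n) ℝ)) : Prop where
  nonneg : 0 ≤ ε
  nonempty : S.Nonempty
  bounded : Bornology.IsBounded S
  prob : 1 - ε ≤ P.real {ω | X ω ∈ S}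

/-- The decoder `g` achieves error probability `ε` for the measurement matrices `A`:
`Pr[g(⟨A₁, X⟩, …, ⟨A_k, X⟩) ≠ X] ≤ ε`. -/
def AchievesErrorProb {Ω : Type*} [MeasurableSpace Ω] (P : Measure Ω) {m n k : ℕ}
    (X : Ω → Matrix (Fin m) (Fin n) ℝ) (A : Fin k → Matrix (Fin m) (Fin n) ℝ)
    (g : (Fin k → ℝ) → Matrix (Fin m) (Fin n) ℝ) (ε : ℝ) : Prop :=
  P.real {ω | g (measurements A (X ω)) ≠ X ω} ≤ ε

end

end MatrixCompletion

/-! Fix `x`. A tuple `A` is bad if some `y ≠ x` in `closure S` has the same measurements. Restrict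
to `‖A i‖ ≤ R` and `‖y - x‖ ≥ δ`, and cover `S` by `N` balls of radius `ρ`. If `y` lies near the
centre `c`, each `A i` lies in a slab `|⟪c - x, a⟫| ≤ R * ρ` of measure `O(ρ)` (`measure_slab_le`),
so the bad set has measure `O(N * ρ ^ k)`. Along suitable scales this is `O(ρ ^ (k - d))` with `d <
k`, hence it is null. Fubini exchanges the quantifiers: for almost every `A`, almost every `x` is
unambiguous. The measurements are injective on the unambiguous points of `closure S`, and
Lusin–Souslin makes the inverse Borel. Passing to the closure costs nothing in the covering and
avoids assuming `S` measurable. -/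

open scoped RealInnerProductSpace ENNReal

namespace MatrixCompletion

section Covering

variable {E : Type*} [PseudoMetricSpace E]

lemma exists_ball_cover [ProperSpace E] {S : Set E} (hS : Bornology.IsBounded S) {ρ : ℝ}
    (hρ : 0 < ρ) :
    ∃ c : Fin (coveringNumber S ρ) → E, S ⊆ ⋃ i, Metric.ball (c i) ρ := by
  have hne : {N : ℕ | ∃ c : Fin N → E, S ⊆ ⋃ i, Metric.ball (c i) ρ}.Nonempty := by
    obtain ⟨t, -, htf, htS⟩ := exists_finite_cover_balls_of_isCompact_closure
      hS.isCompact_closure hρ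
    refine ⟨htf.toFinset.card, fun i => (htf.toFinset.equivFin.symm i : E), fun x hx => ?_⟩
    obtain ⟨y, hy, hxy⟩ := Set.mem_iUnion₂.1 (htS hx)
    exact Set.mem_iUnion.2 ⟨htf.toFinset.equivFin ⟨y, htf.mem_toFinset.2 hy⟩, by simpa using hxy⟩
  exact Nat.sInf_mem hne

lemma frequently_coveringNumber_le {S : Set E} {d : ℝ}
    (hd : lowerMinkowskiDim S < (d : EReal)) :
    ∃ᶠ ρ in 𝓝[>] (0 : ℝ), (coveringNumber S ρ : ℝ) ≤ ρ ^ (-d) := by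
  have h := frequently_lt_of_liminf_lt (by isBoundedDefault) hd
  have hsmall : ∀ᶠ ρ in 𝓝[>] (0 : ℝ), ρ ∈ Set.Ioo (0 : ℝ) 1 := Ioo_mem_nhdsGT one_pos
  refine (h.and_eventually hsmall).mono ?_
  rintro ρ ⟨hlt, hρ0, hρ1⟩
  -- The logarithmic comparison below needs a positive count.
  rcases Nat.eq_zero_or_pos (coveringNumber S ρ) with h0 | hpos
  · rw [h0]
    simpa using Real.rpow_nonneg hρ0.le _
  · have hlog : 0 < Real.log (1 / ρ) := Real.log_pos (by rw [lt_div_iff₀ hρ0]; linarith)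
    rw [EReal.coe_lt_coe_iff, div_lt_iff₀ hlog] at hlt
    have hN : (0 : ℝ) < coveringNumber S ρ := by exact_mod_cast hpos
    rw [← Real.log_le_log_iff hN (Real.rpow_pos_of_pos hρ0 _), Real.log_rpow hρ0]
    rw [one_div, Real.log_inv] at hlt
    linarith

end Covering

section Decoder

/-- Lusin–Souslin: an injective Borel map on a standard Borel space is a measurable embedding. -/
lemma exists_measurable_left_inverse_on {α β : Type*} [MeasurableSpace α] [StandardBorelSpace α]
    [Nonempty α] [MeasurableSpace β] [MeasurableSpace.CountablySeparated β] {f : α → β}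
    (hf : Measurable f) {s : Set α} (hs : MeasurableSet s) (hinj : Set.InjOn f s) :
    ∃ g : β → α, Measurable g ∧ ∀ x ∈ s, g (f x) = x := by
  have := hs.standardBorel
  have hemb : MeasurableEmbedding (s.domRestrict f) :=
    (hf.comp measurable_subtype_coe).measurableEmbedding (Set.injOn_iff_injective.1 hinj)
  obtain ⟨g, hg, hgf⟩ := hemb.exists_measurable_extend measurable_subtype_coe fun _ => inferInstance
  exact ⟨g, hg, fun x hx => congrFun hgf ⟨x, hx⟩⟩

end Decoder

section InnerProduct

variable {E : Type*} [NormedAddCommGroup E] [InnerProductSpace ℝ E] [FiniteDimensional ℝ E]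

/-- The linear map `a ↦ a + φ a • e` replaces the `e`-component of `a` by `⟪c, a⟫ / t`. It sends the
slab into a fixed ball and has determinant `‖c‖ / t`. -/
lemma measure_slab_le [MeasurableSpace E] [BorelSpace E] (μ : Measure E) [μ.IsAddHaarMeasure]
    {R t : ℝ} (ht : 0 < t) {c : E} (hc : c ≠ 0) :
    μ {a | ‖a‖ ≤ R ∧ |⟪c, a⟫| ≤ t} ≤
      ENNReal.ofReal (t / ‖c‖) * μ (Metric.closedBall 0 (2 * R + 1)) := by
  have hc' : 0 < ‖c‖ := norm_pos_iff.2 hc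
  set e : E := ‖c‖⁻¹ • c with he
  have hnorm : ‖e‖ = 1 := by
    rw [he, norm_smul, norm_inv, norm_norm, inv_mul_cancel₀ hc'.ne']
  have hce : ⟪c, e⟫ = ‖c‖ := by
    rw [he, inner_smul_right, real_inner_self_eq_norm_sq]
    field_simp
  have hee : ⟪e, e⟫ = 1 := by rw [real_inner_self_eq_norm_sq, hnorm, one_pow]
  let φ : Module.Dual ℝ E := t⁻¹ • innerₗ E c - innerₗ E e
  have hφ : ∀ a, φ a = t⁻¹ * ⟪c, a⟫ - ⟪e, a⟫ := fun a => by simp [φ]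
  have hdet : LinearMap.det (LinearMap.transvection φ e) = ‖c‖ / t := by
    rw [LinearMap.transvection.det, hφ, hce, hee]
    field_simp
    ring
  have hdet0 : 0 < ‖c‖ / t := by positivity
  have hsub : {a | ‖a‖ ≤ R ∧ |⟪c, a⟫| ≤ t} ⊆
      LinearMap.transvection φ e ⁻¹' Metric.closedBall 0 (2 * R + 1) := by
    rintro a ⟨haR, hat⟩
    rw [Set.mem_preimage, mem_closedBall_zero_iff, LinearMap.transvection.apply]
    have h1 : |t⁻¹ * ⟪c, a⟫| ≤ 1 := by
      rw [abs_mul, abs_of_pos (inv_pos.2 ht), inv_mul_le_iff₀ ht, mul_one]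
      exact hat
    have h2 : |⟪e, a⟫| ≤ R := (abs_real_inner_le_norm e a).trans (by rw [hnorm, one_mul]; exact haR)
    have h3 : ‖φ a • e‖ ≤ 1 + R := by
      rw [norm_smul, hnorm, mul_one, Real.norm_eq_abs, hφ]
      exact (abs_sub _ _).trans (add_le_add h1 h2)
    linarith [norm_add_le a (φ a • e)]
  refine (measure_mono hsub).trans_eq ?_
  rw [Measure.addHaar_preimage_linearMap μ (by rw [hdet]; exact hdet0.ne'), hdet,
    abs_of_pos (inv_pos.2 hdet0), inv_div]

lemma measure_exists_orthogonal_eq_zero_of_bounded [MeasurableSpace E] [BorelSpace E]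
    (μ : Measure E) [μ.IsAddHaarMeasure] {k : ℕ} {S : Set E} (hS : Bornology.IsBounded S)
    (hk : lowerMinkowskiDim S < ((k : ℝ) : EReal)) (x : E) {R δ : ℝ} (hR : 0 < R) (hδ : 0 < δ) :
    (Measure.pi fun _ : Fin k => μ)
      {A | (∀ i, ‖A i‖ ≤ R) ∧ ∃ y ∈ closure S, δ ≤ ‖y - x‖ ∧ ∀ i, ⟪A i, y - x⟫ = 0} = 0 := by
  obtain ⟨d, hSd, hdk⟩ := EReal.lt_iff_exists_real_btwn.1 hk
  have hdk : d < k := EReal.coe_lt_coe_iff.1 hdk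
  set M := μ (Metric.closedBall (0 : E) (2 * R + 1)) with hM
  have hMtop : M ≠ ∞ := measure_closedBall_lt_top.ne
  set T := {A : Fin k → E | (∀ i, ‖A i‖ ≤ R) ∧
    ∃ y ∈ closure S, δ ≤ ‖y - x‖ ∧ ∀ i, ⟪A i, y - x⟫ = 0} with hT
  set C : ℝ≥0∞ := (ENNReal.ofReal (2 * R / δ) * M) ^ k with hC
  have hCtop : C ≠ ∞ := ENNReal.pow_ne_top (ENNReal.mul_ne_top ENNReal.ofReal_ne_top hMtop)
  have hbound : ∃ᶠ ρ in 𝓝[>] (0 : ℝ),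
      (Measure.pi fun _ : Fin k => μ) T ≤ ENNReal.ofReal (ρ ^ ((k : ℝ) - d)) * C := by
    have hsmall : ∀ᶠ ρ in 𝓝[>] (0 : ℝ), ρ ∈ Set.Ioo (0 : ℝ) (δ / 2) :=
      Ioo_mem_nhdsGT (half_pos hδ)
    refine ((frequently_coveringNumber_le hSd).and_eventually hsmall).mono ?_
    rintro ρ ⟨hN, hρ0, hρδ⟩
    obtain ⟨c, hc⟩ := exists_ball_cover hS hρ0
    have hcl : closure S ⊆ ⋃ i, Metric.closedBall (c i) ρ :=
      closure_minimal (hc.trans (Set.iUnion_mono fun i => Metric.ball_subset_closedBall))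
        (isClosed_iUnion_of_finite fun i => Metric.isClosed_closedBall)
    -- Centres close to `x` get an empty slab, so `‖c j - x‖` is bounded below wherever it is
    -- divided by.
    let slab : Fin (coveringNumber S ρ) → Set (Fin k → E) := fun j =>
      {A | δ / 2 ≤ ‖c j - x‖ ∧ ∀ i, ‖A i‖ ≤ R ∧ |⟪c j - x, A i⟫| ≤ R * ρ}
    have hTsub : T ⊆ ⋃ j, slab j := by
      rintro A ⟨hAR, y, hy, hyx, hAy⟩
      obtain ⟨j, hj⟩ := Set.mem_iUnion.1 (hcl hy)
      have hyc : ‖y - c j‖ ≤ ρ := by simpa [dist_eq_norm] using hj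
      have hsplit : y - x = (y - c j) + (c j - x) := by abel
      refine Set.mem_iUnion.2 ⟨j, ?_, fun i => ⟨hAR i, ?_⟩⟩
      · have := norm_add_le (y - c j) (c j - x)
        rw [← hsplit] at this
        linarith
      · have h0 := hAy i
        rw [hsplit, inner_add_right] at h0
        rw [real_inner_comm, show ⟪A i, c j - x⟫ = -⟪A i, y - c j⟫ by linarith, abs_neg]
        exact (abs_real_inner_le_norm _ _).trans
          (mul_le_mul (hAR i) hyc (norm_nonneg _) hR.le)
    have hslab : ∀ j, (Measure.pi fun _ : Fin k => μ) (slab j) ≤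
        (ENNReal.ofReal ρ) ^ k * C := by
      intro j
      by_cases hj : δ / 2 ≤ ‖c j - x‖
      · have hcx : 0 < ‖c j - x‖ := (half_pos hδ).trans_le hj
        have hpi : slab j = Set.univ.pi fun _ : Fin k =>
            {a | ‖a‖ ≤ R ∧ |⟪c j - x, a⟫| ≤ R * ρ} := by
          ext A
          simp [slab, hj]
        rw [hpi, Measure.pi_pi, Finset.prod_const, Finset.card_univ, Fintype.card_fin, hC,
          ← mul_pow, ← mul_assoc, ← ENNReal.ofReal_mul hρ0.le]
        gcongr
        refine (measure_slab_le μ (mul_pos hR hρ0) (norm_pos_iff.1 hcx)).trans ?_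
        gcongr
        rw [div_le_iff₀ hcx]
        calc R * ρ = ρ * (2 * R / δ) * (δ / 2) := by field_simp
          _ ≤ _ := by gcongr
      · have : slab j = ∅ := by
          ext A
          simp [slab, hj]
        simp [this]
    calc (Measure.pi fun _ : Fin k => μ) T
        ≤ ∑ j, (Measure.pi fun _ : Fin k => μ) (slab j) :=
          (measure_mono hTsub).trans (measure_iUnion_fintype_le _ _)
      _ ≤ ∑ _j : Fin (coveringNumber S ρ), (ENNReal.ofReal ρ) ^ k * C :=
          Finset.sum_le_sum fun j _ => hslab j
      _ = ENNReal.ofReal (coveringNumber S ρ * ρ ^ k) * C := by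
          rw [Finset.sum_const, Finset.card_univ, Fintype.card_fin, nsmul_eq_mul,
            ENNReal.ofReal_mul (Nat.cast_nonneg _), ENNReal.ofReal_natCast,
            ENNReal.ofReal_pow hρ0.le, mul_assoc]
      _ ≤ ENNReal.ofReal (ρ ^ ((k : ℝ) - d)) * C := by
          gcongr
          rw [sub_eq_neg_add, Real.rpow_add hρ0, Real.rpow_natCast]
          gcongr
  have hlim : Tendsto (fun ρ : ℝ => ENNReal.ofReal (ρ ^ ((k : ℝ) - d)) * C) (𝓝[>] 0) (𝓝 0) := by
    have h1 : Tendsto (fun ρ : ℝ => ρ ^ ((k : ℝ) - d)) (𝓝[>] 0) (𝓝 0) := by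
      have := (Real.continuousAt_rpow_const 0 ((k : ℝ) - d) (Or.inr (sub_pos.2 hdk).le)).tendsto
      rw [Real.zero_rpow (sub_pos.2 hdk).ne'] at this
      exact this.mono_left nhdsWithin_le_nhds
    have h2 := ENNReal.Tendsto.mul_const (ENNReal.tendsto_ofReal h1) (Or.inr hCtop)
    simpa using h2
  -- The lower dimension controls only arbitrarily small scales, not all of them; that suffices for
  -- a bound on a fixed measure.
  exact le_antisymm (ge_of_tendsto_of_frequently hlim hbound) zero_le

lemma ae_forall_orthogonal_eq [MeasurableSpace E] [BorelSpace E]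
    (μ : Measure E) [μ.IsAddHaarMeasure] {k : ℕ} {S : Set E} (hS : Bornology.IsBounded S)
    (hk : lowerMinkowskiDim S < ((k : ℝ) : EReal)) (x : E) :
    ∀ᵐ A ∂(Measure.pi fun _ : Fin k => μ),
      ∀ y ∈ closure S, (∀ i, ⟪A i, y - x⟫ = 0) → y = x := by
  have hnull : ∀ p : ℕ × ℕ, ∀ᵐ A ∂(Measure.pi fun _ : Fin k => μ),
      ¬ ((∀ i, ‖A i‖ ≤ (p.1 : ℝ) + 1) ∧
        ∃ y ∈ closure S, 1 / ((p.2 : ℝ) + 1) ≤ ‖y - x‖ ∧ ∀ i, ⟪A i, y - x⟫ = 0) := fun p =>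
    measure_eq_zero_iff_ae_notMem.1
      (measure_exists_orthogonal_eq_zero_of_bounded μ hS hk x (by positivity) (by positivity))
  filter_upwards [ae_all_iff.2 hnull] with A hA y hy hAy
  by_contra hne
  obtain ⟨q, hq⟩ := exists_nat_one_div_lt (norm_pos_iff.2 (sub_ne_zero.2 hne))
  obtain ⟨p, hp⟩ := exists_nat_ge ‖A‖
  exact hA (p, q) ⟨fun i => (norm_le_pi_norm A i).trans (by linarith), y, hy, hq.le, hAy⟩

/-- Needed for Fubini. The complement is a countable union of projections of closed sets along the
compact `K`, hence of closed sets. -/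
lemma measurableSet_forall_orthogonal_eq [MeasurableSpace E] [BorelSpace E] {k : ℕ} {K : Set E}
    (hK : IsCompact K) :
    MeasurableSet {p : (Fin k → E) × E | ∀ y ∈ K, (∀ i, ⟪p.1 i, y - p.2⟫ = 0) → y = p.2} := by
  have : CompactSpace K := isCompact_iff_compactSpace.1 hK
  let F : ℕ → Set (((Fin k → E) × E) × K) := fun q =>
    {z | 1 / ((q : ℝ) + 1) ≤ ‖(z.2 : E) - z.1.2‖ ∧ ∀ i, ⟪z.1.1 i, (z.2 : E) - z.1.2⟫ = 0}
  have hF : ∀ q, IsClosed (F q) := fun q => by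
    have hF' : F q = {z | 1 / ((q : ℝ) + 1) ≤ ‖(z.2 : E) - z.1.2‖} ∩
        ⋂ i, {z | ⟪z.1.1 i, (z.2 : E) - z.1.2⟫ = 0} := by ext; simp [F]
    rw [hF']
    exact (isClosed_le (by fun_prop) (by fun_prop)).inter
      (isClosed_iInter fun i => isClosed_eq (by fun_prop) continuous_const)
  have heq : {p : (Fin k → E) × E | ∀ y ∈ K, (∀ i, ⟪p.1 i, y - p.2⟫ = 0) → y = p.2} =
      (⋃ q, Prod.fst '' F q)ᶜ := by
    ext p
    simp only [Set.mem_ofPred_eq, Set.mem_compl_iff, Set.mem_iUnion, Set.mem_image, not_exists]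
    constructor
    · rintro h q z ⟨⟨hq, hz⟩, rfl⟩
      have h0 := h z.2 z.2.2 hz
      rw [h0, sub_self, norm_zero] at hq
      exact absurd hq (not_le.2 (by positivity))
    · intro h y hy hAy
      by_contra hne
      obtain ⟨q, hq⟩ := exists_nat_one_div_lt (norm_pos_iff.2 (sub_ne_zero.2 hne))
      exact h q (p, ⟨y, hy⟩) ⟨⟨hq.le, hAy⟩, rfl⟩
  rw [heq]
  exact (MeasurableSet.iUnion fun q =>
    (isClosedMap_fst_of_compactSpace _ (hF q)).measurableSet).compl

/-- For almost every `A`, a random vector `X` is recovered from the inner products `⟪A i, X⟫`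
by a measurable decoder, up to the event that `X` leaves a measurable superset of `S`. -/
theorem ae_exists_measurable_decoder [MeasurableSpace E] [BorelSpace E]
    (μ : Measure E) [μ.IsAddHaarMeasure] {k : ℕ} {S : Set E} (hS : Bornology.IsBounded S)
    (hk : lowerMinkowskiDim S < ((k : ℝ) : EReal)) (ν : Measure E) [SFinite ν] :
    ∃ K, MeasurableSet K ∧ S ⊆ K ∧
      ∀ᵐ A ∂(Measure.pi fun _ : Fin k => μ), ∃ g : (Fin k → ℝ) → E, Measurable g ∧
        ∀ᵐ x ∂ν, x ∈ K → g (fun i => ⟪A i, x⟫) = x := by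
  refine ⟨closure S, isClosed_closure.measurableSet, subset_closure, ?_⟩
  have hmeas := measurableSet_forall_orthogonal_eq (k := k) hS.isCompact_closure
  filter_upwards [(Measure.ae_ae_comm (μ := Measure.pi fun _ : Fin k => μ) (ν := ν) hmeas).2
    (Eventually.of_forall fun x => ae_forall_orthogonal_eq μ hS hk x)] with A hA
  set f : E → Fin k → ℝ := fun x i => ⟪A i, x⟫ with hf
  have hfm : Measurable f := Continuous.measurable (by fun_prop)
  set G : Set E := closure S ∩ {x | ∀ y ∈ closure S, (∀ i, ⟪A i, y - x⟫ = 0) → y = x} with hG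
  have hGm : MeasurableSet G :=
    isClosed_closure.measurableSet.inter (measurable_prodMk_left hmeas)
  have hinj : Set.InjOn f G := fun y hy x hx hyx =>
    hx.2 y hy.1 fun i => by rw [inner_sub_right, sub_eq_zero]; exact congrFun hyx i
  obtain ⟨g, hg, hgf⟩ := exists_measurable_left_inverse_on hfm hGm hinj
  refine ⟨g, hg, ?_⟩
  filter_upwards [hA] with x hx hxS
  exact hgf x ⟨hxS, hx⟩

end InnerProduct

section Matrix

attribute [local instance] Matrix.frobeniusNormedSpace

lemma traceInner_eq_sum {m n : ℕ} (A B : Matrix (Fin m) (Fin n) ℝ) :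
    traceInner A B = ∑ i, ∑ j, A i j * B i j := by
  rw [traceInner, Matrix.trace, Finset.sum_comm]
  simp [Matrix.mul_apply]

/-- The trace inner product as an inner product space structure inducing the Frobenius norm. -/
noncomputable abbrev traceInnerProductSpace (m n : ℕ) :
    InnerProductSpace ℝ (Matrix (Fin m) (Fin n) ℝ) where
  inner := traceInner
  norm_sq_eq_re_inner A := by
    rw [Matrix.frobenius_norm_def, ← Real.sqrt_eq_rpow, Real.sq_sqrt (by positivity)]
    simp [traceInner_eq_sum, pow_two]
  conj_inner_symm A B := by simp [traceInner_eq_sum, mul_comm]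
  add_left A B C := by simp [traceInner_eq_sum, add_mul, Finset.sum_add_distrib]
  smul_left A B r := by simp [traceInner_eq_sum, mul_assoc, Finset.mul_sum]

/-- The Frobenius topology is by definition the entrywise one. -/
lemma borelSpace_matrix_frobenius (m n : ℕ) :
    @BorelSpace (Matrix (Fin m) (Fin n) ℝ)
      (inferInstance : PseudoMetricSpace (Matrix (Fin m) (Fin n) ℝ)).toUniformSpace.toTopologicalSpace
      _ :=
  inferInstanceAs (BorelSpace (Fin m → Fin n → ℝ))

lemma isAddHaarMeasure_volume_pi_pi (m n : ℕ) :
    (volume : Measure (Fin m → Fin n → ℝ)).IsAddHaarMeasure := by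
  exact Measure.pi.isAddHaarMeasure fun _ => (volume : Measure (Fin n → ℝ))

lemma isAddHaarMeasure_matrixLebesgue (m n : ℕ) :
    @Measure.IsAddHaarMeasure (Matrix (Fin m) (Fin n) ℝ) _
      (inferInstance : PseudoMetricSpace (Matrix (Fin m) (Fin n) ℝ)).toUniformSpace.toTopologicalSpace
      _ (matrixLebesgue m n) :=
  isAddHaarMeasure_volume_pi_pi m n

end Matrix

end MatrixCompletion

theorem theorem1 {Ω : Type*} [MeasurableSpace Ω] (P : Measure Ω) [IsProbabilityMeasure P]
    {m n k : ℕ} (X : Ω → Matrix (Fin m) (Fin n) ℝ) (hX : Measurable X)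
    (ε : ℝ) (S : Set (Matrix (Fin m) (Fin n) ℝ))
    (hS : MatrixCompletion.IsSupportSet P X ε S)
    (hk : MatrixCompletion.lowerMinkowskiDim S < ((k : ℝ) : EReal)) :
    ∀ᵐ A ∂(Measure.pi fun _ : Fin k => MatrixCompletion.matrixLebesgue m n),
      ∃ g : (Fin k → ℝ) → Matrix (Fin m) (Fin n) ℝ,
        Measurable g ∧ MatrixCompletion.AchievesErrorProb P X A g ε := by
  let := MatrixCompletion.traceInnerProductSpace m n
  have := MatrixCompletion.borelSpace_matrix_frobenius m n
  have := MatrixCompletion.isAddHaarMeasure_matrixLebesgue m n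
  obtain ⟨K, hK, hSK, hdec⟩ := MatrixCompletion.ae_exists_measurable_decoder
    (MatrixCompletion.matrixLebesgue m n) hS.bounded hk (P.map X)
  filter_upwards [hdec] with A hA
  obtain ⟨g, hg, hgX⟩ := hA
  refine ⟨g, hg, ?_⟩
  have hcl : MeasurableSet (X ⁻¹' K) := hX hK
  have herr : P {ω | g (MatrixCompletion.measurements A (X ω)) ≠ X ω} ≤ P (X ⁻¹' K)ᶜ := by
    refine measure_mono_ae ?_
    filter_upwards [ae_of_ae_map hX.aemeasurable hgX] with ω hω hne hmem
    exact hne (hω hmem)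
  have hprob : P.real {ω | X ω ∈ S} ≤ P.real (X ⁻¹' K) :=
    measureReal_mono fun ω hω => hSK hω
  calc P.real {ω | g (MatrixCompletion.measurements A (X ω)) ≠ X ω}
      ≤ P.real (X ⁻¹' K)ᶜ := ENNReal.toReal_mono (measure_ne_top _ _) herr
    _ = 1 - P.real (X ⁻¹' K) := probReal_compl_eq_one_sub hcl
    _ ≤ ε := by linarith [hS.prob]
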